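/- Let $\rho,\kappa>0$. There is a constant $C>0$ depending only on $\rho$ and $\kappa$ such that the following holds. Let $\Omega\subset\mathbb{R}^2$ be a domain (open, connected) and $\mathcal{T}_h$ a finite conforming triangulation of $\overline\Omega$ by closed nondegenerate triangles. Let $\Omega_1,\dots,\Omega_N\subset\Omega$ be pairwise disjoint open connected sets with $\overline\Omega=\bigcup_i\overline{\Omega}_i$ such that every $\partial\Omega_i$ is a union of edges of $\mathcal{T}_h$. Put $\mathcal{T}_h(\Omega_i)=\{K\in\mathcal{T}_h: K\subset\overline\Omega_i\}$, $H_i=\operatorname{diam}\Omega_i$ and $h_i=\max_{K\in\mathcal{T}_h(\Omega_i)}\operatorname{diam}K$. Assume (a) (shape-regular, quasi-uniform meshes) every $K\in\mathcal{T}_h(\Omega_i)$ contains a disc of radius $\rho h_i$; (b) (shape-regular subdomains) for each $i$ there is a map $\varphi_i$ of the closed unit disc onto $\overline\Omega_i$ that maps the open unit disc onto $\Omega_i$ and satisfies $\kappa^{-1}H_i|x-y|\le|\varphi_i(x)-\varphi_i(y)|\le\kappa H_i|x-y|$. Let $\alpha$ be measurable and essentially bounded on $\Omega$ with $\alpha\ge\alpha_0$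 almost everywhere for some constant $\alpha_0>0$ (for instance, $\alpha$ piecewise $W^{1,\infty}$). Let $V_h$ be the Crouzeix–Raviart space: functions that are affine on each $K\in\mathcal{T}_h$, single-valued at the midpoints of the edges, and zero at the edge midpoints on $\partial\Omega$. Let $$a(u,v)=\sum_{K\in\mathcal{T}_h}\int_K\alpha\,\nabla u\cdot\nabla v\,dx ,\qquad u,v\in V_h.$$ For $u\in V_h$ let $I_Au\in V_h$ be the function with $(I_Au)(x)=u(x)$ at the edge midpoints $x\in\partial\Omega_i$ and $(I_Au)(x)=\hat u_i$ at the edge midpoints $x\in\Omega_i$, $i=1,\dots,N$, where $\hat u_i$ is the arithmetic mean of the values of $u$ at all edge midpoints on $\partial\Omega_i$. Let $\Omega_i^\delta$ be the union of the triangles of $\mathcal{T}_h(\Omega_i)$ that touch $\partial\Omega_i$ (in an edge or a vertex), and let $\overline\alpha_i$ and $\underline\alpha_i$ be the essential supremum and infimum of $\alpha$ on $\Omega_i^\delta$. Then $$a(I_Au,I_Au)\le C\,\max_i\left(\frac{\overline\alpha_i}{\underline\alpha_i}\,\frac{H_i^2}{h_i^2}\right)a(u,u)\qquad\text{for all }u\in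 V_h .$$ -/

import Mathlib

open MeasureTheory

namespace CRSchwarz

noncomputable section

/-- The Euclidean plane. -/
abbrev Plane : Type := EuclideanSpace ℝ (Fin 2)

/-- The closed convex hull of a finite set of points (a closed triangle, or a closed edge). -/
abbrev hull (K : Finset Plane) : Set Plane := convexHull ℝ (K : Set Plane)

/-- The edges of the triangle with vertex set `K`, as two-point sets. -/
def edges (K : Finset Plane) : Finset (Finset Plane) := K.powersetCard 2

/-- The midpoint of an edge. -/
def mid (e : Finset Plane) : Plane := e.centroid ℝ id

/-- The Crouzeix-Raviart nodes of a triangle: the midpoints of its edges. -/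
def nodes (K : Finset Plane) : Set Plane := mid '' (edges K : Set (Finset Plane))

/-- A conforming triangulation of `Ω` into finitely many nondegenerate closed triangles, each given
by its set of vertices: two triangles meet at most in a common face. -/
structure Triangulation (Ω : Set Plane) where
  tri : Finset (Finset Plane)
  card_eq : ∀ K ∈ tri, K.card = 3
  indep : ∀ K ∈ tri, AffineIndependent ℝ (fun p : K => (p : Plane))
  conforming : ∀ K ∈ tri, ∀ L ∈ tri,
    hull K ∩ hull L ⊆ convexHull ℝ ((K : Set Plane) ∩ (L : Set Plane))
  cover : closure Ω = ⋃ K ∈ tri, hull K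

namespace Triangulation

variable {Ω : Set Plane} (T : Triangulation Ω)

open scoped Classical in
/-- All edges of the triangulation. -/
def allEdges : Finset (Finset Plane) := T.tri.biUnion edges

open scoped Classical in
/-- All Crouzeix-Raviart nodes (edge midpoints) of the triangulation. -/
def allNodes : Finset Plane := T.allEdges.image mid

/-- The Crouzeix-Raviart space `V_h`. A piecewise affine function is given by its affine pieces,
one for every triangle; the pieces have a common value at every shared edge midpoint, and the
value is zero at the edge midpoints on `∂Ω`. -/
def crSpace : Submodule ℝ (T.tri → (Plane →ᵃ[ℝ] ℝ)) where
  carrier := {u | (∀ K L : T.tri, ∀ x ∈ nodes K.1 ∩ nodes L.1, u K x = u L x) ∧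
    ∀ K : T.tri, ∀ x ∈ nodes K.1, x ∈ frontier Ω → u K x = 0}
  zero_mem' := by simp
  add_mem' := by
    rintro u v ⟨hu, hu'⟩ ⟨hv, hv'⟩
    refine ⟨fun K L x hx => ?_, fun K x hx hx' => ?_⟩
    · simp [hu K L x hx, hv K L x hx]
    · simp [hu' K x hx hx', hv' K x hx hx']
  smul_mem' := by
    rintro c u ⟨hu, hu'⟩
    refine ⟨fun K L x hx => ?_, fun K x hx hx' => ?_⟩
    · simp [hu K L x hx]
    · simp [hu' K x hx hx']

open scoped Classical in
/-- The value `u(x)` of a Crouzeix-Raviart function at a node `x`. -/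
def nodalValue (u : T.crSpace) (x : Plane) : ℝ :=
  if h : ∃ K : T.tri, x ∈ nodes K.1 then u.1 h.choose x else 0

theorem nodalValue_eq (u : T.crSpace) (K : T.tri) {x : Plane} (hx : x ∈ nodes K.1) :
    T.nodalValue u x = u.1 K x := by
  have h : ∃ K : T.tri, x ∈ nodes K.1 := ⟨K, hx⟩
  rw [nodalValue, dif_pos h]
  exact u.2.1 _ _ x ⟨h.choose_spec, hx⟩

/-- The nonconforming finite element bilinear form `∑_K ∫_K α ∇u · ∇v`. -/
def energy (α : Plane → ℝ) (u v : T.crSpace) : ℝ :=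
  ∑ K : T.tri, ∫ x in hull K.1, α x * inner ℝ (gradient (u.1 K) x) (gradient (v.1 K) x)

/-- The vertices of a triangle as an affine basis of the plane. -/
def basis (K : T.tri) : AffineBasis K.1 ℝ Plane where
  toFun := fun p => (p : Plane)
  ind' := T.indep K.1 K.2
  tot' := by
    rw [(T.indep K.1 K.2).affineSpan_eq_top_iff_card_eq_finrank_add_one]
    simp [T.card_eq K.1 K.2]

open scoped Classical in
/-- The affine function on `K` with prescribed values at the three edge midpoints: the nodal basis
function of the edge opposite to the vertex `p` is `1 - 2 λ_p`, with `λ_p` barycentric. -/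
def localInterp (c : Plane → ℝ) (K : T.tri) : Plane →ᵃ[ℝ] ℝ :=
  ∑ p : K.1, c (mid (K.1.erase p.1)) •
    (AffineMap.const ℝ Plane (1 : ℝ) - (2 : ℝ) • (T.basis K).coord p)

theorem localInterp_apply (c : Plane → ℝ) (K : T.tri) {x : Plane} (hx : x ∈ nodes K.1) :
    T.localInterp c K x = c x := by
  classical
  obtain ⟨e, he, rfl⟩ := hx
  have he' : e ⊆ K.1 ∧ e.card = 2 := by simpa [edges, Finset.mem_powersetCard] using he
  obtain ⟨p, q, hpq, rfl⟩ := Finset.card_eq_two.1 he'.2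
  have hp : p ∈ K.1 := he'.1 (by simp)
  have hq : q ∈ K.1 := he'.1 (by simp)
  have hm : mid {p, q} = midpoint ℝ p q := by
    rw [mid, Finset.centroid_pair]
    simp only [id, midpoint, AffineMap.lineMap_apply]
    norm_num
  have hcoord : ∀ r : K.1, (T.basis K).coord r (midpoint ℝ p q) =
      ((if r.1 = p then 1 else 0) + (if r.1 = q then 1 else 0)) / 2 := by
    intro r
    have h1 : (T.basis K).coord r p = if r.1 = p then 1 else 0 := by
      have := (T.basis K).coord_apply r ⟨p, hp⟩
      simp only [Subtype.ext_iff] at this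
      exact this
    have h2 : (T.basis K).coord r q = if r.1 = q then 1 else 0 := by
      have := (T.basis K).coord_apply r ⟨q, hq⟩
      simp only [Subtype.ext_iff] at this
      exact this
    rw [AffineMap.map_midpoint, h1, h2]
    simp only [midpoint_eq_smul_add, smul_eq_mul]
    norm_num
    ring
  -- the third vertex
  have hcard : (K.1 \ {p, q}).card = 1 := by
    rw [Finset.card_sdiff_of_subset he'.1, T.card_eq K.1 K.2, he'.2]
  obtain ⟨s, hs⟩ := Finset.card_eq_one.1 hcard
  have hsK : s ∈ K.1 ∧ s ≠ p ∧ s ≠ q := by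
    have : s ∈ K.1 \ {p, q} := by rw [hs]; simp
    simpa using this
  have hK : ∀ r ∈ K.1, r ≠ s → r = p ∨ r = q := by
    intro r hr hrs
    by_contra hne
    have : r ∈ K.1 \ {p, q} := by
      simp only [Finset.mem_sdiff, Finset.mem_insert, Finset.mem_singleton]
      exact ⟨hr, hne⟩
    rw [hs] at this
    exact hrs (by simpa using this)
  have herase : K.1.erase s = {p, q} := by
    ext r
    simp only [Finset.mem_erase, Finset.mem_insert, Finset.mem_singleton]
    constructor
    · rintro ⟨h1, h2⟩
      exact hK r h2 h1
    · rintro (rfl | rfl)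
      · exact ⟨hsK.2.1.symm, hp⟩
      · exact ⟨hsK.2.2.symm, hq⟩
  have hval : T.localInterp c K (midpoint ℝ p q) =
      ∑ r : K.1, c (mid (K.1.erase r.1)) *
        (1 - 2 * (T.basis K).coord r (midpoint ℝ p q)) := by
    rw [localInterp]
    have key : ∀ (S : Finset K.1) (f : K.1 → Plane →ᵃ[ℝ] ℝ) (y : Plane),
        (∑ r ∈ S, f r) y = ∑ r ∈ S, f r y := by
      intro S f y
      induction S using Finset.induction_on with
      | empty => simp
      | insert a S ha ih => rw [Finset.sum_insert ha, Finset.sum_insert ha, ← ih]; rfl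
    rw [key]
    rfl
  rw [hm, hval, Finset.sum_eq_single ⟨s, hsK.1⟩]
  · rw [hcoord, herase, hm]
    simp [hsK.2.1, hsK.2.2]
  · intro r _ hr
    have hr' : r.1 ≠ s := fun h => hr (Subtype.ext h)
    rw [hcoord]
    rcases hK r.1 r.2 hr' with h | h
    · rw [h]; simp [hpq]
    · rw [h]; simp [hpq.symm]
  · simp

end Triangulation

/-- A nonoverlapping decomposition of `Ω` into open connected subdomains whose boundaries are
unions of edges of the triangulation. -/
structure Decomposition {Ω : Set Plane} (T : Triangulation Ω) (N : ℕ) where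
  sub : Fin N → Set Plane
  isOpen : ∀ i, IsOpen (sub i)
  isConnected : ∀ i, IsConnected (sub i)
  subset : ∀ i, sub i ⊆ Ω
  disjoint : ∀ i j, i ≠ j → Disjoint (sub i) (sub j)
  cover : closure Ω = ⋃ i, closure (sub i)
  aligned : ∀ i, ∃ S ⊆ T.allEdges, frontier (sub i) = ⋃ e ∈ S, hull e

namespace Decomposition

variable {Ω : Set Plane} {T : Triangulation Ω} {N : ℕ} (D : Decomposition T N)

open scoped Classical in
/-- The triangles of the subdomain `Ω_i`. -/
def localTri (i : Fin N) : Finset (Finset Plane) :=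
  T.tri.filter fun K => hull K ⊆ closure (D.sub i)

open scoped Classical in
/-- The triangles of the subdomain `Ω_i` that have a point on `∂Ω_i`. -/
def layerTri (i : Fin N) : Finset (Finset Plane) :=
  (D.localTri i).filter fun K => (hull K ∩ frontier (D.sub i)).Nonempty

/-- The boundary layer `Ω_i^δ`: the union of the triangles of `Ω_i` that touch `∂Ω_i`. -/
def layer (i : Fin N) : Set Plane :=
  ⋃ K ∈ D.layerTri i, hull K

/-- The diameter `H_i` of the subdomain `Ω_i`. -/
def coarseSize (i : Fin N) : ℝ := Metric.diam (D.sub i)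

/-- The mesh size `h_i` in `Ω_i`: the largest diameter of a triangle of `Ω_i`. -/
def meshSize (i : Fin N) : ℝ := ⨆ K : D.localTri i, Metric.diam (hull K.1)

/-- The supremum of the coefficient over the boundary layer (essential, since the coefficient is
an element of `L^∞`). -/
def alphaSup (α : Plane → ℝ) (i : Fin N) : ℝ := essSup α (volume.restrict (D.layer i))

/-- The infimum of the coefficient over the boundary layer. -/
def alphaInf (α : Plane → ℝ) (i : Fin N) : ℝ := essInf α (volume.restrict (D.layer i))

open scoped Classical in
/-- The Crouzeix-Raviart nodes on `∂Ω_i`. -/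
def bdryNodes (i : Fin N) : Finset Plane := T.allNodes.filter fun x => x ∈ frontier (D.sub i)

/-- The mean of `u` over the Crouzeix-Raviart nodes on `∂Ω_i`. -/
def bdryMean (u : T.crSpace) (i : Fin N) : ℝ :=
  1 / ((D.bdryNodes i).card : ℝ) * ∑ x ∈ D.bdryNodes i, T.nodalValue u x

open scoped Classical in
/-- The nodal values of the average interpolant: the boundary mean at nodes inside a subdomain,
the value of `u` at all other nodes, which lie on subdomain boundaries. -/
def avgValue (u : T.crSpace) (x : Plane) : ℝ :=
  if h : ∃ i, x ∈ D.sub i then D.bdryMean u h.choose else T.nodalValue u x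

theorem notMem_sub_of_mem_frontier {x : Plane} {i : Fin N} (hx : x ∈ frontier (D.sub i)) :
    ¬ ∃ j, x ∈ D.sub j := by
  rintro ⟨j, hj⟩
  by_cases hij : i = j
  · subst hij
    rw [(D.isOpen i).frontier_eq] at hx
    exact hx.2 hj
  · obtain ⟨y, hyj, hyi⟩ :=
      mem_closure_iff.1 (frontier_subset_closure hx) _ (D.isOpen j) hj
    exact Set.disjoint_left.1 (D.disjoint i j hij) hyi hyj

theorem avgValue_interior (u : T.crSpace) {x : Plane} {i : Fin N} (hx : x ∈ D.sub i) :
    D.avgValue u x = D.bdryMean u i := by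
  have h : ∃ i, x ∈ D.sub i := ⟨i, hx⟩
  have h2 : h.choose = i := by
    by_contra hne
    exact Set.disjoint_left.1 (D.disjoint _ _ hne) h.choose_spec hx
  rw [avgValue, dif_pos h, h2]

theorem avgValue_boundary (u : T.crSpace) {x : Plane} {i : Fin N} (hx : x ∈ frontier (D.sub i)) :
    D.avgValue u x = T.nodalValue u x := by
  rw [avgValue, dif_neg (D.notMem_sub_of_mem_frontier hx)]

/-- The average interpolant `I_A u`, an element of the Crouzeix-Raviart space. -/
def avgInterp (u : T.crSpace) : T.crSpace :=
  ⟨T.localInterp (D.avgValue u), by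
    refine ⟨fun K L x hx => ?_, fun K x hx hx' => ?_⟩
    · rw [T.localInterp_apply _ K hx.1, T.localInterp_apply _ L hx.2]
    · rw [T.localInterp_apply _ K hx]
      have hn : ¬ ∃ i, x ∈ D.sub i := by
        rintro ⟨i, hi⟩
        have : x ∈ interior Ω := interior_maximal (D.subset i) (D.isOpen i) hi
        exact hx'.2 this
      rw [avgValue, dif_neg hn, T.nodalValue_eq u K hx]
      exact u.2.2 K x hx hx'⟩

theorem avgInterp_interior (u : T.crSpace) (K : T.tri) {x : Plane} (hx : x ∈ nodes K.1)
    {i : Fin N} (hi : x ∈ D.sub i) : (D.avgInterp u).1 K x = D.bdryMean u i := by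
  rw [← D.avgValue_interior u hi]
  exact T.localInterp_apply _ K hx

theorem avgInterp_boundary (u : T.crSpace) (K : T.tri) {x : Plane} (hx : x ∈ nodes K.1)
    {i : Fin N} (hi : x ∈ frontier (D.sub i)) : (D.avgInterp u).1 K x = u.1 K x := by
  rw [← T.nodalValue_eq u K hx, ← D.avgValue_boundary u hi]
  exact T.localInterp_apply _ K hx

/-- The triangulation of every subdomain is shape regular and quasi-uniform with constant `ρ`:
each of its triangles contains a disc of radius `ρ h_i`. -/
def QuasiUniform (ρ : ℝ) : Prop :=
  ∀ i, ∀ K ∈ D.localTri i, ∃ z, Metric.closedBall z (ρ * D.meshSize i) ⊆ hull K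

/-- The subdomains are shape regular with constant `κ`: each closed subdomain is the image of the
closed unit disc, and each subdomain the image of the open unit disc, under a bi-Lipschitz map
whose constants are `κ H_i` and, for the inverse, `κ / H_i`. -/
def ShapeRegular (κ : ℝ) : Prop :=
  ∀ i, ∃ φ : Plane → Plane,
    φ '' Metric.ball 0 1 = D.sub i ∧
    φ '' Metric.closedBall 0 1 = closure (D.sub i) ∧
    ∀ x ∈ Metric.closedBall (0 : Plane) 1, ∀ y ∈ Metric.closedBall (0 : Plane) 1,
      κ⁻¹ * D.coarseSize i * dist x y ≤ dist (φ x) (φ y) ∧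
      dist (φ x) (φ y) ≤ κ * D.coarseSize i * dist x y

end Decomposition

/-- An elliptic coefficient on `Ω`: measurable, essentially bounded, and bounded below by a
positive constant. -/
structure IsCoefficient (Ω : Set Plane) (α : Plane → ℝ) : Prop where
  aemeasurable : AEMeasurable α (volume.restrict Ω)
  bddAbove : ∃ M : ℝ, ∀ᵐ x ∂volume.restrict Ω, α x ≤ M
  bddBelow : ∃ α₀ : ℝ, 0 < α₀ ∧ ∀ᵐ x ∂volume.restrict Ω, α₀ ≤ α x

end

end CRSchwarz

open MeasureTheory

namespace CRSchwarz

noncomputable section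

/-! ### Affine functions on the plane -/

/-! Each triangle lies in exactly one closed subdomain, so the energy splits into local energies and
it suffices to argue for one index `i`. On a triangle not touching `∂Ω_i` all three nodal values of
`I_A u` equal the boundary mean, so its gradient vanishes there and only the `n` layer triangles
contribute. On those, the nodal values differ from the mean by at most the oscillation of `u` over
the boundary nodes.

That oscillation is bounded by `layerOsc`, the sum of `h |∇u|` over the layer: any two layer
triangles are joined by a chain of layer triangles with consecutive ones sharing a node, and a
Crouzeix-Raviart function is single-valued at such nodes (`layerGraph_reachable`,
`abs_sub_le_walk`). The chain exists because the chart image of a circle of radius slightly below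
one is connected, meets every layer triangle, and avoids all vertices and all other triangles of
`Ω_i`.

Counting by area gives `n ≤ C H/h`: pulled back to the unit disc, the layer triangles contain
disjoint discs of radius of order `h/H` inside an annulus of width of order `h/H`
(`card_layerFinset_le`). One factor `n` comes from Cauchy-Schwarz applied to `layerOsc`
(`layerOsc_sq_le`), the other from summing the energy of `I_A u` over the layer
(`localEnergy_avgInterp_le_layerOsc`). Together they give `H²/h²`, while the coefficient enters only
through its bounds on the layer. -/

theorem hasGradientAt_affine (f : Plane →ᵃ[ℝ] ℝ) (x : Plane) :
    HasGradientAt f ((InnerProductSpace.toDual ℝ Plane).symm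
      (LinearMap.toContinuousLinearMap f.linear)) x := by
  rw [hasGradientAt_iff_hasFDerivAt, LinearIsometryEquiv.apply_symm_apply]
  have h := (LinearMap.toContinuousLinearMap f.linear).hasFDerivAt (x := x)
  have h2 := h.add_const (f 0)
  refine h2.congr_of_eventuallyEq (Filter.Eventually.of_forall fun y => ?_)
  have := f.decomp
  exact congrFun this y

theorem gradient_affine (f : Plane →ᵃ[ℝ] ℝ) (x : Plane) : gradient f x = gradient f 0 := by
  rw [(hasGradientAt_affine f x).gradient, (hasGradientAt_affine f 0).gradient]

theorem affine_sub_eq_inner (f : Plane →ᵃ[ℝ] ℝ) (x y : Plane) :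
    f x - f y = inner ℝ (gradient f 0) (x - y) := by
  rw [(hasGradientAt_affine f 0).gradient, InnerProductSpace.toDual_symm_apply]
  have := f.linearMap_vsub x y
  simpa using this.symm

theorem abs_affine_sub_le (f : Plane →ᵃ[ℝ] ℝ) (x y : Plane) :
    |f x - f y| ≤ ‖gradient f 0‖ * dist x y := by
  rw [affine_sub_eq_inner, dist_eq_norm]
  exact abs_real_inner_le_norm _ _

/-- An affine function bounded on a disc of radius `r` has a gradient bounded accordingly. -/
theorem mul_norm_gradient_le {f : Plane →ᵃ[ℝ] ℝ} {z : Plane} {r c B : ℝ} (hr : 0 ≤ r)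
    (hB : ∀ x ∈ Metric.closedBall z r, |f x - c| ≤ B) : r * ‖gradient f 0‖ ≤ B := by
  set g := gradient f 0 with hg
  by_cases h0 : g = 0
  · have := hB z (by simpa using hr)
    rw [h0, norm_zero, mul_zero]
    exact (abs_nonneg _).trans this
  have hn : 0 < ‖g‖ := norm_pos_iff.2 h0
  -- The points `z ± v` are the ends of the diameter along the gradient, where `f` differs by
  -- exactly `2 r ‖g‖`.
  set v := (r / ‖g‖) • g with hv
  have hvn : ‖v‖ = r := by
    rw [hv, norm_smul, Real.norm_of_nonneg (by positivity)]
    field_simp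
  have h1 := hB (z + v) (by simp [hvn])
  have h2 := hB (z - v) (by simp [hvn])
  have h3 := affine_sub_eq_inner f (z + v) (z - v)
  have h4 : inner ℝ g (z + v - (z - v)) = 2 * (r * ‖g‖) := by
    have : z + v - (z - v) = (2 : ℝ) • v := by rw [two_smul]; abel
    rw [this, inner_smul_right, hv, inner_smul_right, real_inner_self_eq_norm_sq]
    field_simp
  rw [← hg, h4] at h3
  rw [abs_le] at h1 h2
  linarith [h1.1, h1.2, h2.1, h2.2]

theorem convexHull_abs_sub_le {f : Plane →ᵃ[ℝ] ℝ} {S : Set Plane} {c B : ℝ}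
    (h : ∀ x ∈ S, |f x - c| ≤ B) : ∀ x ∈ convexHull ℝ S, |f x - c| ≤ B := by
  have hc : Convex ℝ (f ⁻¹' Set.Icc (c - B) (c + B)) := (convex_Icc _ _).affine_preimage f
  have : convexHull ℝ S ⊆ f ⁻¹' Set.Icc (c - B) (c + B) := by
    refine convexHull_min (fun x hx => ?_) hc
    have := abs_le.1 (h x hx)
    constructor <;> linarith [this.1, this.2]
  intro x hx
  have := this hx
  rw [abs_le]
  constructor <;> linarith [this.1, this.2]

/-! ### Triangles -/

theorem mid_pair (p q : Plane) : mid {p, q} = midpoint ℝ p q := by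
  classical
  have := Finset.centroid_pair ℝ (id : Plane → Plane) p q
  rw [mid, this]
  simp only [id, midpoint, AffineMap.lineMap_apply]
  norm_num

theorem affine_mid_pair (f : Plane →ᵃ[ℝ] ℝ) (p q : Plane) :
    f (mid {p, q}) = (f p + f q) / 2 := by
  rw [mid_pair, AffineMap.map_midpoint]
  simp only [midpoint_eq_smul_add, smul_eq_mul]
  norm_num
  ring

theorem mem_edges {K e : Finset Plane} : e ∈ edges K ↔ e ⊆ K ∧ e.card = 2 := by
  simp [edges, Finset.mem_powersetCard]

theorem mem_nodes {K : Finset Plane} {x : Plane} :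
    x ∈ nodes K ↔ ∃ p ∈ K, ∃ q ∈ K, p ≠ q ∧ mid {p, q} = x := by
  classical
  constructor
  · rintro ⟨e, he, rfl⟩
    obtain ⟨h1, h2⟩ := mem_edges.1 he
    obtain ⟨p, q, hpq, rfl⟩ := Finset.card_eq_two.1 h2
    exact ⟨p, h1 (by simp), q, h1 (by simp), hpq, by congr⟩
  · rintro ⟨p, hp, q, hq, hpq, rfl⟩
    refine ⟨{p, q}, ?_, rfl⟩
    rw [Finset.mem_coe, mem_edges]
    exact ⟨by simp [Finset.insert_subset_iff, hp, hq], Finset.card_pair hpq⟩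

theorem nodes_subset_hull (K : Finset Plane) : nodes K ⊆ hull K := by
  intro x hx
  obtain ⟨p, hp, q, hq, hpq, rfl⟩ := mem_nodes.1 hx
  rw [mid_pair]
  exact (convex_convexHull ℝ _).midpoint_mem (subset_convexHull ℝ _ hp)
    (subset_convexHull ℝ _ hq)

theorem isCompact_hull (K : Finset Plane) : IsCompact (hull K) :=
  K.finite_toSet.isCompact_convexHull ℝ

theorem isClosed_hull (K : Finset Plane) : IsClosed (hull K) := (isCompact_hull K).isClosed

theorem convex_hull (K : Finset Plane) : Convex ℝ (hull K) := convex_convexHull ℝ _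

theorem dist_le_diam_hull {K : Finset Plane} {x y : Plane} (hx : x ∈ hull K) (hy : y ∈ hull K) :
    dist x y ≤ Metric.diam (hull K) :=
  Metric.dist_le_diam_of_mem (isCompact_hull K).isBounded hx hy

/-- An affine function with small values at the three edge midpoints of a triangle containing a
disc of radius `r` has a small gradient. -/
theorem mul_norm_gradient_le_of_nodes {K : Finset Plane} (hK : K.card = 3) {f : Plane →ᵃ[ℝ] ℝ}
    {z : Plane} {r c w : ℝ} (hr : 0 ≤ r) (hz : Metric.closedBall z r ⊆ hull K)
    (hw : ∀ x ∈ nodes K, |f x - c| ≤ w) : r * ‖gradient f 0‖ ≤ 3 * w := by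
  refine mul_norm_gradient_le hr (z := z) (c := c) fun x hx => ?_
  refine convexHull_abs_sub_le (S := (K : Set Plane)) ?_ x (hz hx)
  classical
  obtain ⟨p, q, s, hpq, hps, hqs, rfl⟩ := Finset.card_eq_three.1 hK
  have h1 := hw _ (mem_nodes.2 ⟨p, by simp, q, by simp, hpq, rfl⟩)
  have h2 := hw _ (mem_nodes.2 ⟨p, by simp, s, by simp, hps, rfl⟩)
  have h3 := hw _ (mem_nodes.2 ⟨q, by simp, s, by simp, hqs, rfl⟩)
  rw [affine_mid_pair f, abs_le] at h1
  rw [affine_mid_pair f, abs_le] at h2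
  rw [affine_mid_pair f, abs_le] at h3
  -- A vertex value is the sum of the values at the two adjacent midpoints minus the value at the
  -- opposite one; hence the factor three.
  intro y hy
  simp only [Finset.coe_insert, Finset.coe_singleton, Set.mem_insert_iff,
    Set.mem_singleton_iff] at hy
  rw [abs_le]
  rcases hy with rfl | rfl | rfl <;> constructor <;> linarith [h1.1, h1.2, h2.1, h2.2, h3.1, h3.2]

/-! ### Barycentric coordinates and conformity -/

namespace Triangulation

variable {Ω : Set Plane} (T : Triangulation Ω)

theorem range_basis (K : T.tri) : Set.range (T.basis K) = (K.1 : Set Plane) := by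
  ext x
  constructor
  · rintro ⟨p, rfl⟩
    exact p.2
  · intro hx
    exact ⟨⟨x, hx⟩, rfl⟩

theorem mem_hull_iff (K : T.tri) {x : Plane} :
    x ∈ hull K.1 ↔ ∀ p, 0 ≤ (T.basis K).coord p x := by
  rw [hull, ← T.range_basis K, (T.basis K).convexHull_eq_nonneg_coord]
  rfl

theorem mem_interior_hull_iff (K : T.tri) {x : Plane} :
    x ∈ interior (hull K.1) ↔ ∀ p, 0 < (T.basis K).coord p x := by
  rw [hull, ← T.range_basis K, (T.basis K).interior_convexHull]
  rfl

theorem interior_hull_nonempty (K : T.tri) : (interior (hull K.1)).Nonempty := by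
  rw [hull, ← T.range_basis K]
  exact ⟨_, (T.basis K).centroid_mem_interior_convexHull⟩

theorem closure_interior_hull (K : T.tri) : closure (interior (hull K.1)) = hull K.1 := by
  rw [(convex_hull K.1).closure_interior_eq_closure_of_nonempty_interior
    (T.interior_hull_nonempty K), (isClosed_hull K.1).closure_eq]

theorem hull_subset_closure (K : T.tri) : hull K.1 ⊆ closure Ω := by
  rw [T.cover]
  exact Set.subset_biUnion_of_mem (u := fun K : Finset Plane => hull K) K.2

/-- The barycentric coordinate of a vertex vanishes on the opposite face. -/
theorem coord_eq_zero (K : T.tri) {S : Set Plane} (hS : S ⊆ K.1) {p : K.1} (hp : p.1 ∉ S)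
    {x : Plane} (hx : x ∈ convexHull ℝ S) : (T.basis K).coord p x = 0 := by
  have hc : Convex ℝ ((T.basis K).coord p ⁻¹' {0}) := (convex_singleton 0).affine_preimage _
  suffices hs : S ⊆ (T.basis K).coord p ⁻¹' {0} from convexHull_min hs hc hx
  intro y hy
  have hne : p ≠ ⟨y, hS hy⟩ := by
    rintro rfl
    exact hp hy
  have h0 : (T.basis K).coord p ((T.basis K) ⟨y, hS hy⟩) = 0 := (T.basis K).coord_apply_ne hne
  exact h0

/-- Conformity puts `x` in the hull of the common vertices. A vertex of `K` missing from `L` would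
have zero barycentric coordinate at `x`, whereas all coordinates of an interior point are positive.
-/
theorem eq_of_mem_interior {K L : T.tri} {x : Plane} (hK : x ∈ interior (hull K.1))
    (hL : x ∈ hull L.1) : K = L := by
  have hx := T.conforming K.1 K.2 L.1 L.2 ⟨interior_subset hK, hL⟩
  rw [T.mem_interior_hull_iff] at hK
  have hsub : K.1 ⊆ L.1 := by
    intro p hp
    by_contra hpL
    exact (hK ⟨p, hp⟩).ne' (T.coord_eq_zero K Set.inter_subset_left (fun h => hpL h.2) hx)
  refine Subtype.ext (Finset.eq_of_subset_of_card_le hsub ?_)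
  rw [T.card_eq K.1 K.2, T.card_eq L.1 L.2]

/-- The edges of a triangulation do not meet the open triangles. -/
theorem disjoint_edge_interior {e : Finset Plane} (he : e ∈ T.allEdges) (K : T.tri) :
    Disjoint (hull e) (interior (hull K.1)) := by
  classical
  rw [Set.disjoint_left]
  intro x hxe hxK
  obtain ⟨L, hL, heL⟩ := Finset.mem_biUnion.1 he
  obtain ⟨h1, h2⟩ := mem_edges.1 heL
  have hKL : K = ⟨L, hL⟩ :=
    T.eq_of_mem_interior hxK (convexHull_mono (Finset.coe_subset.2 h1) hxe)
  subst hKL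
  have : ∃ p ∈ L, p ∉ e := by
    by_contra! hcon
    have := Finset.card_le_card hcon
    rw [h2, T.card_eq L hL] at this
    omega
  obtain ⟨p, hp, hpe⟩ := this
  rw [T.mem_interior_hull_iff] at hxK
  exact (hxK ⟨p, hp⟩).ne' (T.coord_eq_zero ⟨L, hL⟩ (Finset.coe_subset.2 h1) hpe hxe)

/-- With at most one common vertex, conformity would force `x` to be that vertex. Two common
vertices span a shared edge, whose midpoint serves. -/
theorem exists_common_node {K L : T.tri} {x : Plane} (hK : x ∈ hull K.1) (hL : x ∈ hull L.1)
    (hx : x ∉ K.1) : ∃ y, y ∈ nodes K.1 ∧ y ∈ nodes L.1 := by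
  have hm := T.conforming K.1 K.2 L.1 L.2 ⟨hK, hL⟩
  have hnt : ((K.1 : Set Plane) ∩ L.1).Nontrivial := by
    by_contra hcon
    rw [Set.not_nontrivial_iff] at hcon
    rcases hcon.eq_empty_or_singleton with h | ⟨p, h⟩
    · rw [h, convexHull_empty] at hm
      exact hm
    · rw [h, convexHull_singleton] at hm
      have hp : p ∈ (K.1 : Set Plane) ∩ L.1 := by rw [h]; rfl
      rw [Set.mem_singleton_iff] at hm
      subst hm
      exact hx hp.1
  obtain ⟨p, hp, q, hq, hpq⟩ := hnt
  exact ⟨mid {p, q}, mem_nodes.2 ⟨p, hp.1, q, hq.1, hpq, rfl⟩,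
    mem_nodes.2 ⟨p, hp.2, q, hq.2, hpq, rfl⟩⟩

/-- A midpoint has positive coordinates at both ends of its edge, so by conformity both ends are
vertices of `L`. -/
theorem mem_nodes_of_mem_hull {K L : T.tri} {x : Plane} (hK : x ∈ nodes K.1)
    (hL : x ∈ hull L.1) : x ∈ nodes L.1 := by
  have hm := T.conforming K.1 K.2 L.1 L.2 ⟨nodes_subset_hull _ hK, hL⟩
  obtain ⟨p, hp, q, hq, hpq, rfl⟩ := mem_nodes.1 hK
  have key : ∀ r : K.1, (r.1 = p ∨ r.1 = q) → r.1 ∈ L.1 := by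
    intro r hr
    by_contra hrL
    have h0 := T.coord_eq_zero K (p := r) Set.inter_subset_left (fun h => hrL h.2) hm
    rw [affine_mid_pair] at h0
    have hn : ∀ s ∈ K.1, 0 ≤ (T.basis K).coord r s := fun s hs =>
      (T.mem_hull_iff K).1 (subset_convexHull ℝ _ hs) r
    have h1 : (T.basis K).coord r r.1 = 1 := (T.basis K).coord_apply_eq r
    have h2 := hn p hp
    have h3 := hn q hq
    rcases hr with h | h <;> rw [h] at h1 <;> linarith
  exact mem_nodes.2 ⟨p, key ⟨p, hp⟩ (Or.inl rfl), q, key ⟨q, hq⟩ (Or.inr rfl), hpq, rfl⟩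

end Triangulation

/-! ### Disc charts of the subdomains -/

/-- A homeomorphism `φ` of the closed unit disc onto the closure of `U` that respects interiors
and boundaries, with inverse `ψ`, Lipschitz in both directions. -/
structure IsDiscChart (U : Set Plane) (A B : ℝ) (φ ψ : Plane → Plane) : Prop where
  mem : ∀ x, ‖x‖ < 1 → φ x ∈ U
  mem_frontier : ∀ x, ‖x‖ = 1 → φ x ∈ frontier U
  norm_le : ∀ y ∈ closure U, ‖ψ y‖ ≤ 1
  norm_eq : ∀ y ∈ frontier U, ‖ψ y‖ = 1
  norm_lt : ∀ y ∈ U, ‖ψ y‖ < 1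
  right_inv : ∀ y ∈ closure U, φ (ψ y) = y
  left_inv : ∀ x, ‖x‖ ≤ 1 → ψ (φ x) = x
  dist_le : ∀ x y, ‖x‖ ≤ 1 → ‖y‖ ≤ 1 → dist (φ x) (φ y) ≤ A * dist x y
  dist_inv_le : ∀ x ∈ closure U, ∀ y ∈ closure U, dist (ψ x) (ψ y) ≤ B * dist x y

namespace Decomposition

variable {Ω : Set Plane} {T : Triangulation Ω} {N : ℕ} (D : Decomposition T N)

theorem frontier_eq (i : Fin N) : frontier (D.sub i) = closure (D.sub i) \ D.sub i :=
  (D.isOpen i).frontier_eq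

/-- If `H_i = 0`, the upper Lipschitz bound collapses the chart to a point, which is impossible for
a nonempty open set. This also rules out the default diameter zero of an unbounded set. -/
theorem coarseSize_pos {κ : ℝ} (h : D.ShapeRegular κ) (i : Fin N) : 0 < D.coarseSize i := by
  obtain ⟨φ, h1, -, h3⟩ := h i
  refine lt_of_le_of_ne Metric.diam_nonneg fun h0 => ?_
  obtain ⟨x, hx⟩ := (D.isConnected i).nonempty
  have hs : D.sub i ⊆ {x} := by
    intro y hy
    rw [← h1] at hx hy
    obtain ⟨a, ha, rfl⟩ := hx
    obtain ⟨b, hb, rfl⟩ := hy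
    have := (h3 b (Metric.ball_subset_closedBall hb) a (Metric.ball_subset_closedBall ha)).2
    have h0' : D.coarseSize i = 0 := h0.symm
    rw [h0', mul_zero, zero_mul] at this
    exact dist_le_zero.1 this
  have hint : x ∈ interior ({x} : Set Plane) := interior_maximal hs (D.isOpen i) hx
  rw [interior_singleton] at hint
  exact hint

theorem exists_chart {κ : ℝ} (hκ : 0 < κ) (h : D.ShapeRegular κ) (i : Fin N) :
    ∃ φ ψ, IsDiscChart (D.sub i) (κ * D.coarseSize i) (κ / D.coarseSize i) φ ψ := by
  classical
  have hH := D.coarseSize_pos h i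
  obtain ⟨φ, h1, h2, h3⟩ := h i
  have hinj : Set.InjOn φ (Metric.closedBall 0 1) := by
    intro x hx y hy hxy
    have := (h3 x hx y hy).1
    rw [hxy, dist_self] at this
    have h4 : 0 < κ⁻¹ * D.coarseSize i := by positivity
    exact dist_le_zero.1 (nonpos_of_mul_nonpos_right this h4)
  set ψ := Function.invFunOn φ (Metric.closedBall 0 1) with hψ
  have hmem : ∀ y ∈ closure (D.sub i), ψ y ∈ Metric.closedBall (0 : Plane) 1 ∧ φ (ψ y) = y := by
    intro y hy
    rw [← h2] at hy
    exact ⟨Function.invFunOn_mem hy, Function.invFunOn_eq hy⟩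
  have hleft : ∀ x, ‖x‖ ≤ 1 → ψ (φ x) = x := by
    intro x hx
    have hx' : x ∈ Metric.closedBall (0 : Plane) 1 := by simpa using hx
    have hc : φ x ∈ closure (D.sub i) := by
      rw [← h2]
      exact ⟨x, hx', rfl⟩
    exact hinj (hmem _ hc).1 hx' (hmem _ hc).2
  have hU : ∀ x, ‖x‖ < 1 → φ x ∈ D.sub i := by
    intro x hx
    rw [← h1]
    exact ⟨x, by simpa using hx, rfl⟩
  have hlt : ∀ y ∈ D.sub i, ‖ψ y‖ < 1 := by
    intro y hy
    rw [← h1] at hy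
    obtain ⟨x, hx, rfl⟩ := hy
    have hx' : ‖x‖ < 1 := by simpa using hx
    rw [hleft x hx'.le]
    exact hx'
  refine ⟨φ, ψ, hU, ?_, ?_, ?_, hlt, fun y hy => (hmem y hy).2, hleft, ?_, ?_⟩
  · intro x hx
    rw [D.frontier_eq]
    refine ⟨?_, fun hc => ?_⟩
    · rw [← h2]
      exact ⟨x, by simp [hx], rfl⟩
    · have := hlt _ hc
      rw [hleft x hx.le, hx] at this
      exact lt_irrefl _ this
  · intro y hy
    simpa using (hmem y hy).1
  · intro y hy
    rw [D.frontier_eq] at hy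
    refine le_antisymm (by simpa using (hmem y hy.1).1) ?_
    by_contra! hlt'
    have := hU _ hlt'
    rw [(hmem y hy.1).2] at this
    exact hy.2 this
  · intro x y hx hy
    exact (h3 x (by simpa using hx) y (by simpa using hy)).2
  · intro x hx y hy
    have := (h3 _ (hmem x hx).1 _ (hmem y hy).1).1
    rw [(hmem x hx).2, (hmem y hy).2] at this
    calc dist (ψ x) (ψ y) = κ / D.coarseSize i *
          (κ⁻¹ * D.coarseSize i * dist (ψ x) (ψ y)) := by field_simp
      _ ≤ κ / D.coarseSize i * dist x y := by gcongr

/-! ### Triangles of a subdomain -/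

theorem disjoint_frontier_interior (i : Fin N) (K : T.tri) :
    Disjoint (frontier (D.sub i)) (interior (hull K.1)) := by
  obtain ⟨S, hS, he⟩ := D.aligned i
  rw [he, Set.disjoint_iUnion₂_left]
  exact fun e he => T.disjoint_edge_interior (hS he) K

/-- An open triangle is connected and misses `∂Ω_i`, so it lies either in `Ω_i` or outside its
closure. -/
theorem interior_subset_of_mem {i : Fin N} {K : T.tri} {x : Plane}
    (hx : x ∈ interior (hull K.1)) (hxi : x ∈ closure (D.sub i)) :
    interior (hull K.1) ⊆ D.sub i := by
  have hpre : IsPreconnected (interior (hull K.1)) := (convex_hull K.1).interior.isPreconnected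
  have hdis := Set.disjoint_right.1 (D.disjoint_frontier_interior i K)
  refine hpre.subset_left_of_subset_union (D.isOpen i) isClosed_closure.isOpen_compl
    (Set.disjoint_compl_right_iff_subset.2 subset_closure) (fun y hy => ?_) ⟨x, hx, ?_⟩
  · by_cases hyc : y ∈ closure (D.sub i)
    · left
      by_contra hyi
      exact hdis hy (by rw [D.frontier_eq]; exact ⟨hyc, hyi⟩)
    · exact Or.inr hyc
  · by_contra hxn
    exact hdis hx (by rw [D.frontier_eq]; exact ⟨hxi, hxn⟩)

theorem mem_localTri (i : Fin N) (K : T.tri) :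
    K.1 ∈ D.localTri i ↔ hull K.1 ⊆ closure (D.sub i) := by
  simp [localTri]

theorem mem_localTri_of_mem {i : Fin N} {K : T.tri} {x : Plane}
    (hx : x ∈ interior (hull K.1)) (hxi : x ∈ closure (D.sub i)) : K.1 ∈ D.localTri i := by
  rw [mem_localTri, ← T.closure_interior_hull K]
  exact closure_mono (D.interior_subset_of_mem hx hxi)

theorem interior_subset {i : Fin N} {K : T.tri} (hK : K.1 ∈ D.localTri i) :
    interior (hull K.1) ⊆ D.sub i := by
  obtain ⟨x, hx⟩ := T.interior_hull_nonempty K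
  exact D.interior_subset_of_mem hx ((D.mem_localTri i K).1 hK (_root_.interior_subset hx))

theorem exists_mem_localTri (K : T.tri) : ∃ i, K.1 ∈ D.localTri i := by
  obtain ⟨x, hx⟩ := T.interior_hull_nonempty K
  have := T.hull_subset_closure K (_root_.interior_subset hx)
  rw [D.cover, Set.mem_iUnion] at this
  obtain ⟨i, hi⟩ := this
  exact ⟨i, D.mem_localTri_of_mem hx hi⟩

theorem localTri_unique {i j : Fin N} {K : T.tri} (hi : K.1 ∈ D.localTri i)
    (hj : K.1 ∈ D.localTri j) : i = j := by
  obtain ⟨x, hx⟩ := T.interior_hull_nonempty K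
  by_contra hij
  exact Set.disjoint_left.1 (D.disjoint i j hij) (D.interior_subset hi hx)
    (D.interior_subset hj hx)

/-- The triangles of `Ω_i` cover the closure of `Ω_i`. -/
theorem exists_localTri_of_mem_closure {i : Fin N} {x : Plane} (hx : x ∈ closure (D.sub i)) :
    ∃ K : T.tri, K.1 ∈ D.localTri i ∧ x ∈ hull K.1 := by
  have hcl : IsClosed (⋃ K ∈ {K : T.tri | K.1 ∈ D.localTri i}, hull K.1) :=
    (Set.toFinite _).isClosed_biUnion fun K _ => isClosed_hull K.1
  have hsub : D.sub i ⊆ ⋃ K ∈ {K : T.tri | K.1 ∈ D.localTri i}, hull K.1 := by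
    intro y hy
    have hyc := subset_closure (D.subset i hy)
    rw [T.cover] at hyc
    simp only [Set.mem_iUnion] at hyc ⊢
    obtain ⟨K, hK, hyK⟩ := hyc
    -- The triangle containing `y` may have `y` on its boundary, but its interior accumulates at `y`
    -- and so meets the open set `Ω_i`.
    have hyK' : y ∈ closure (interior (hull K)) := by
      rw [T.closure_interior_hull ⟨K, hK⟩]
      exact hyK
    obtain ⟨z, hz, hzK⟩ := mem_closure_iff.1 hyK' _ (D.isOpen i) hy
    exact ⟨⟨K, hK⟩, D.mem_localTri_of_mem (K := ⟨K, hK⟩) hzK (subset_closure hz), hyK⟩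
  have := closure_minimal hsub hcl hx
  simp only [Set.mem_iUnion] at this
  obtain ⟨K, hK, hxK⟩ := this
  exact ⟨K, hK, hxK⟩

theorem mem_layerTri (i : Fin N) (K : T.tri) :
    K.1 ∈ D.layerTri i ↔ K.1 ∈ D.localTri i ∧ (hull K.1 ∩ frontier (D.sub i)).Nonempty := by
  simp [layerTri]

theorem exists_layerTri_of_mem_frontier {i : Fin N} {x : Plane} (hx : x ∈ frontier (D.sub i)) :
    ∃ K : T.tri, K.1 ∈ D.layerTri i ∧ x ∈ hull K.1 := by
  obtain ⟨K, hK, hxK⟩ := D.exists_localTri_of_mem_closure (frontier_subset_closure hx)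
  exact ⟨K, (D.mem_layerTri i K).2 ⟨hK, x, hxK, hx⟩, hxK⟩

theorem mem_bdryNodes {i : Fin N} {x : Plane} :
    x ∈ D.bdryNodes i ↔ (∃ K : T.tri, x ∈ nodes K.1) ∧ x ∈ frontier (D.sub i) := by
  classical
  have : x ∈ T.allNodes ↔ ∃ K : T.tri, x ∈ nodes K.1 := by
    simp only [Triangulation.allNodes, Triangulation.allEdges, Finset.mem_image,
      Finset.mem_biUnion, nodes, Set.mem_image, Finset.mem_coe]
    constructor
    · rintro ⟨e, ⟨K, hK, he⟩, rfl⟩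
      exact ⟨⟨K, hK⟩, e, he, rfl⟩
    · rintro ⟨K, e, he, rfl⟩
      exact ⟨e, ⟨K.1, K.2, he⟩, rfl⟩
  rw [bdryNodes, Finset.mem_filter, this]

/-- A node on `∂Ω_i` is a node of a triangle of the boundary layer of `Ω_i`. -/
theorem exists_layerTri_of_mem_bdryNodes {i : Fin N} {x : Plane} (hx : x ∈ D.bdryNodes i) :
    ∃ K : T.tri, K.1 ∈ D.layerTri i ∧ x ∈ nodes K.1 := by
  obtain ⟨⟨L, hL⟩, hxf⟩ := D.mem_bdryNodes.1 hx
  obtain ⟨K, hK, hxK⟩ := D.exists_layerTri_of_mem_frontier hxf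
  exact ⟨K, hK, T.mem_nodes_of_mem_hull hL hxK⟩

/-! ### Connectedness of the boundary layer -/

/-- The dual graph of the boundary layer: two triangles are adjacent if they share a node. -/
def layerGraph (i : Fin N) : SimpleGraph T.tri :=
  SimpleGraph.fromRel fun K L =>
    K.1 ∈ D.layerTri i ∧ L.1 ∈ D.layerTri i ∧ ∃ x, x ∈ nodes K.1 ∧ x ∈ nodes L.1

theorem layerGraph_adj {i : Fin N} {K L : T.tri} :
    (D.layerGraph i).Adj K L ↔ K ≠ L ∧ K.1 ∈ D.layerTri i ∧ L.1 ∈ D.layerTri i ∧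
      ∃ x, x ∈ nodes K.1 ∧ x ∈ nodes L.1 := by
  rw [layerGraph, SimpleGraph.fromRel_adj]
  constructor
  · rintro ⟨h, h1 | ⟨h1, h2, x, h3, h4⟩⟩
    · exact ⟨h, h1⟩
    · exact ⟨h, h2, h1, x, h4, h3⟩
  · rintro ⟨h, h1⟩
    exact ⟨h, Or.inl h1⟩

variable {A B : ℝ} {φ ψ : Plane → Plane}

theorem continuousOn_chart {U : Set Plane} (hc : IsDiscChart U A B φ ψ) :
    ContinuousOn φ (Metric.closedBall 0 1) := by
  refine LipschitzOnWith.continuousOn (K := A.toNNReal) (LipschitzOnWith.of_dist_le_mul ?_)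
  intro x hx y hy
  refine (hc.dist_le x y (by simpa using hx) (by simpa using hy)).trans ?_
  gcongr
  exact Real.le_coe_toNNReal A

theorem continuousOn_chart_inv {U : Set Plane} (hc : IsDiscChart U A B φ ψ) :
    ContinuousOn ψ (closure U) := by
  refine LipschitzOnWith.continuousOn (K := B.toNNReal) (LipschitzOnWith.of_dist_le_mul ?_)
  intro x hx y hy
  refine (hc.dist_inv_le x hx y hy).trans ?_
  gcongr
  exact Real.le_coe_toNNReal B

open Filter Topology

/-- On a layer triangle `‖ψ‖` takes the value one at a boundary point and a smaller value at an
interior point, hence everything in between. -/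
theorem eventually_circle_meets_layerTri {i : Fin N} (hc : IsDiscChart (D.sub i) A B φ ψ)
    {K : T.tri} (hK : K.1 ∈ D.layerTri i) :
    ∀ᶠ s in 𝓝[<] (1 : ℝ), ∃ x, ‖x‖ = s ∧ φ x ∈ hull K.1 := by
  obtain ⟨hKl, p, hpK, hpf⟩ := (D.mem_layerTri i K).1 hK
  have hsub := (D.mem_localTri i K).1 hKl
  obtain ⟨z, hz⟩ := T.interior_hull_nonempty K
  have hz1 := hc.norm_lt z (D.interior_subset hKl hz)
  have hcont : ContinuousOn (fun y => ‖ψ y‖) (hull K.1) :=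
    ((continuousOn_chart_inv hc).mono hsub).norm
  have hivt := (convex_hull K.1).isPreconnected.intermediate_value
    (_root_.interior_subset hz) hpK hcont
  filter_upwards [Ioo_mem_nhdsLT hz1] with s hs
  obtain ⟨y, hy, hys⟩ := hivt ⟨hs.1.le, by simpa only [hc.norm_eq p hpf] using hs.2.le⟩
  exact ⟨ψ y, hys, by rw [hc.right_inv y (hsub hy)]; exact hy⟩

/-- A triangle off the boundary is a compact subset of `Ω_i`, so `‖ψ‖` has a maximum below one on
it. -/
theorem eventually_circle_avoids {i : Fin N} (hc : IsDiscChart (D.sub i) A B φ ψ)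
    {K : T.tri} (hK : K.1 ∈ D.localTri i) (hKl : K.1 ∉ D.layerTri i) :
    ∀ᶠ s in 𝓝[<] (1 : ℝ), ∀ x, ‖x‖ = s → φ x ∉ hull K.1 := by
  have hsub := (D.mem_localTri i K).1 hK
  have hcont : ContinuousOn (fun y => ‖ψ y‖) (hull K.1) :=
    ((continuousOn_chart_inv hc).mono hsub).norm
  obtain ⟨y, hy, hmax⟩ := (isCompact_hull K.1).exists_isMaxOn
    ((T.interior_hull_nonempty K).mono _root_.interior_subset) hcont
  have hy1 : ‖ψ y‖ < 1 := by
    refine hc.norm_lt y ?_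
    by_contra hyi
    refine hKl ((D.mem_layerTri i K).2 ⟨hK, y, hy, ?_⟩)
    rw [D.frontier_eq]
    exact ⟨hsub hy, hyi⟩
  filter_upwards [Ioo_mem_nhdsLT hy1] with s hs x hx hxK
  have := hmax hxK
  simp only [Set.mem_ofPred_eq] at this
  rw [hc.left_inv x (hx.trans_le hs.2.le), hx] at this
  exact absurd hs.1 (not_lt.2 this)

/-- Only the circle of radius `‖ψ v‖` can pass through `v`, so a single radius is excluded. -/
theorem eventually_circle_ne {i : Fin N} (hc : IsDiscChart (D.sub i) A B φ ψ) (v : Plane) :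
    ∀ᶠ s in 𝓝[<] (1 : ℝ), ∀ x, ‖x‖ = s → φ x ≠ v := by
  have h1 : ∀ᶠ s in 𝓝[<] (1 : ℝ), s ≠ ‖ψ v‖ := by
    by_cases h : ‖ψ v‖ < 1
    · filter_upwards [Ioo_mem_nhdsLT h] with s hs
      exact hs.1.ne'
    · filter_upwards [self_mem_nhdsWithin] with s hs
      exact (lt_of_lt_of_le hs (not_lt.1 h)).ne
  filter_upwards [h1, self_mem_nhdsWithin] with s hs hs1 x hx hxv
  have h1' : ‖x‖ ≤ 1 := hx.trans_le (le_of_lt hs1)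
  exact hs (by rw [← hxv, hc.left_inv x h1', hx])

theorem one_lt_rank_plane : 1 < Module.rank ℝ Plane := by
  rw [← Module.finrank_eq_rank, finrank_euclideanSpace_fin]
  norm_num

/-- Any two triangles of the boundary layer are joined by a chain of layer triangles. -/
theorem layerGraph_reachable {i : Fin N} (hc : IsDiscChart (D.sub i) A B φ ψ)
    {K L : T.tri} (hK : K.1 ∈ D.layerTri i) (hL : L.1 ∈ D.layerTri i) :
    (D.layerGraph i).Reachable K L := by
  classical
  have hall : ∀ᶠ s in 𝓝[<] (1 : ℝ), ∀ J : T.tri, J.1 ∈ D.localTri i → J.1 ∉ D.layerTri i →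
      ∀ x, ‖x‖ = s → φ x ∉ hull J.1 := by
    refine eventually_all.2 fun J => ?_
    by_cases h1 : J.1 ∈ D.localTri i
    · by_cases h2 : J.1 ∈ D.layerTri i
      · exact Eventually.of_forall fun s _ h => absurd h2 h
      · filter_upwards [D.eventually_circle_avoids hc h1 h2] with s hs _ _
        exact hs
    · exact Eventually.of_forall fun s h => absurd h h1
  have hvert : ∀ᶠ s in 𝓝[<] (1 : ℝ), ∀ J : T.tri, ∀ v ∈ J.1, ∀ x, ‖x‖ = s → φ x ≠ v :=
    eventually_all.2 fun J => (Filter.eventually_all_finset J.1).2 fun v _ =>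
      D.eventually_circle_ne hc v
  obtain ⟨s, ⟨⟨⟨⟨hsK, hsL⟩, hsall⟩, hsv⟩, hs0⟩⟩ := ((((
    (D.eventually_circle_meets_layerTri hc hK).and (D.eventually_circle_meets_layerTri hc hL)).and
    hall).and hvert).and (Ioo_mem_nhdsLT (zero_lt_one (α := ℝ)))).exists
  have hcircle : IsPreconnected (φ '' Metric.sphere (0 : Plane) s) := by
    refine (isPreconnected_sphere one_lt_rank_plane 0 s).image φ
      ((continuousOn_chart hc).mono fun x hx => ?_)
    rw [mem_sphere_zero_iff_norm] at hx
    rw [mem_closedBall_zero_iff, hx]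
    exact hs0.2.le
  -- Otherwise the layer triangles reachable from `K` and the unreachable ones give two closed sets
  -- that cover the connected curve and both meet it. A common point is not a vertex, so it yields a
  -- shared node and an edge between the two classes.
  by_contra hKL
  set F : Set T.tri → Set Plane := fun S => ⋃ J ∈ S, hull J.1 with hF
  have hcl : ∀ S, IsClosed (F S) := fun S =>
    (Set.toFinite _).isClosed_biUnion fun J _ => isClosed_hull J.1
  set S₁ : Set T.tri := {J | J.1 ∈ D.layerTri i ∧ (D.layerGraph i).Reachable K J} with hS₁
  set S₂ : Set T.tri := {J | J.1 ∈ D.layerTri i ∧ ¬ (D.layerGraph i).Reachable K J} with hS₂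
  have hmemF : ∀ S y, y ∈ F S ↔ ∃ J ∈ S, y ∈ hull J.1 := by
    intro S y
    simp only [hF, Set.mem_iUnion, exists_prop]
  have hcov : φ '' Metric.sphere (0 : Plane) s ⊆ F S₁ ∪ F S₂ := by
    rintro _ ⟨x, hx, rfl⟩
    rw [mem_sphere_zero_iff_norm] at hx
    obtain ⟨J, hJ, hxJ⟩ := D.exists_localTri_of_mem_closure
      (subset_closure (hc.mem x (hx.trans_lt hs0.2)))
    have hJl : J.1 ∈ D.layerTri i := by
      by_contra hJl
      exact hsall J hJ hJl x hx hxJ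
    by_cases hr : (D.layerGraph i).Reachable K J
    · exact Or.inl ((hmemF _ _).2 ⟨J, ⟨hJl, hr⟩, hxJ⟩)
    · exact Or.inr ((hmemF _ _).2 ⟨J, ⟨hJl, hr⟩, hxJ⟩)
  obtain ⟨a, ha, haK⟩ := hsK
  obtain ⟨b, hb, hbL⟩ := hsL
  obtain ⟨_, ⟨x, hx, rfl⟩, hx1, hx2⟩ := isPreconnected_closed_iff.1 hcircle _ _ (hcl S₁) (hcl S₂)
    hcov ⟨φ a, ⟨a, by simpa using ha, rfl⟩, (hmemF _ _).2 ⟨K, ⟨hK, .refl _⟩, haK⟩⟩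
    ⟨φ b, ⟨b, by simpa using hb, rfl⟩, (hmemF _ _).2 ⟨L, ⟨hL, hKL⟩, hbL⟩⟩
  rw [mem_sphere_zero_iff_norm] at hx
  obtain ⟨J₁, ⟨hl1, hr1⟩, hxJ1⟩ := (hmemF _ _).1 hx1
  obtain ⟨J₂, ⟨hl2, hr2⟩, hxJ2⟩ := (hmemF _ _).1 hx2
  have hcommon := T.exists_common_node hxJ1 hxJ2 fun hv => hsv J₁ _ hv x hx rfl
  have hne : J₁ ≠ J₂ := by
    rintro rfl
    exact hr2 hr1
  exact hr2 (hr1.trans (D.layerGraph_adj.2 ⟨hne, hl1, hl2, hcommon⟩).reachable)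

end Decomposition

/-! ### Counting the layer triangles by area -/

theorem volume_real_ball (x : Plane) {r : ℝ} (hr : 0 ≤ r) :
    (volume : Measure Plane).real (Metric.ball x r) = Real.pi * r ^ 2 := by
  rw [measureReal_def, EuclideanSpace.volume_ball_fin_two, ENNReal.toReal_mul, ENNReal.toReal_pow,
    ENNReal.toReal_ofReal hr, ENNReal.toReal_ofReal Real.pi_pos.le, mul_comm]

theorem volume_real_closedBall (x : Plane) {r : ℝ} (hr : 0 ≤ r) :
    (volume : Measure Plane).real (Metric.closedBall x r) = Real.pi * r ^ 2 := by
  rw [measureReal_def, EuclideanSpace.volume_closedBall_fin_two, ENNReal.toReal_mul,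
    ENNReal.toReal_pow, ENNReal.toReal_ofReal hr, ENNReal.toReal_ofReal Real.pi_pos.le, mul_comm]

/-- The number of disjoint discs of radius `r` in an annulus of outer radius one and width `δ`. -/
theorem card_mul_sq_le_of_disjoint_balls {ι : Type*} (S : Finset ι) (c : ι → Plane) {r δ : ℝ}
    (hr : 0 ≤ r) (hδ : 0 ≤ δ)
    (hdisj : (S : Set ι).PairwiseDisjoint fun k => Metric.ball (c k) r)
    (hsub : ∀ k ∈ S, ∀ x ∈ Metric.ball (c k) r, 1 - δ ≤ ‖x‖ ∧ ‖x‖ < 1) :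
    (S.card : ℝ) * r ^ 2 ≤ 2 * δ := by
  -- The truncation covers `δ > 1`, where the annulus is the whole disc.
  set t := max 0 (1 - δ) with ht
  have ht0 : 0 ≤ t := le_max_left _ _
  have ht1 : t ≤ 1 := max_le zero_le_one (by linarith)
  have hun : (⋃ k ∈ S, Metric.ball (c k) r) ⊆ Metric.ball (0 : Plane) 1 \ Metric.ball 0 t := by
    intro x hx
    simp only [Set.mem_iUnion] at hx
    obtain ⟨k, hk, hxk⟩ := hx
    obtain ⟨h1, h2⟩ := hsub k hk x hxk
    rw [Set.mem_sdiff, mem_ball_zero_iff, mem_ball_zero_iff, not_lt]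
    exact ⟨h2, max_le (norm_nonneg _) h1⟩
  have hfin : volume (Metric.ball (0 : Plane) 1 \ Metric.ball 0 t) ≠ ⊤ :=
    ((measure_mono Set.sdiff_subset).trans_lt measure_ball_lt_top).ne
  have h1 := measureReal_mono (μ := (volume : Measure Plane)) hun hfin
  rw [measureReal_biUnion_finset hdisj (fun _ _ => measurableSet_ball)
      (fun _ _ => measure_ball_lt_top.ne),
    measureReal_sdiff (Metric.ball_subset_ball ht1) measurableSet_ball measure_ball_lt_top.ne,
    volume_real_ball _ zero_le_one, volume_real_ball _ ht0,
    Finset.sum_congr rfl fun k _ => volume_real_ball (c k) hr, Finset.sum_const,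
    nsmul_eq_mul] at h1
  have h2 : (S.card : ℝ) * r ^ 2 ≤ 1 - t ^ 2 := by
    refine le_of_mul_le_mul_left ?_ Real.pi_pos
    linarith
  -- The bound follows from `1 - t² = (1 - t)(1 + t) ≤ 2 (1 - t) ≤ 2 δ`.
  have h3 : 1 - δ ≤ t := le_max_right _ _
  nlinarith

namespace Decomposition

variable {Ω : Set Plane} {T : Triangulation Ω} {N : ℕ} (D : Decomposition T N)

theorem diam_le_meshSize {i : Fin N} {K : T.tri} (hK : K.1 ∈ D.localTri i) :
    Metric.diam (hull K.1) ≤ D.meshSize i :=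
  le_ciSup (f := fun K : D.localTri i => Metric.diam (hull K.1)) (Set.finite_range _).bddAbove
    ⟨K.1, hK⟩

theorem meshSize_pos {i : Fin N} {K : T.tri} (hK : K.1 ∈ D.localTri i) : 0 < D.meshSize i := by
  refine lt_of_lt_of_le ?_ (D.diam_le_meshSize hK)
  have h1 : 1 < K.1.card := by rw [T.card_eq K.1 K.2]; norm_num
  obtain ⟨p, hp, q, hq, hpq⟩ := Finset.one_lt_card.1 h1
  exact (dist_pos.2 hpq).trans_le
    (dist_le_diam_hull (subset_convexHull ℝ _ hp) (subset_convexHull ℝ _ hq))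

theorem layer_local {i : Fin N} {K : T.tri} (hK : K.1 ∈ D.layerTri i) : K.1 ∈ D.localTri i :=
  ((D.mem_layerTri i K).1 hK).1

open scoped Classical in
/-- The boundary layer triangles of `Ω_i`, as elements of the triangulation. -/
def layerFinset (i : Fin N) : Finset T.tri := Finset.univ.filter fun K => K.1 ∈ D.layerTri i

theorem mem_layerFinset {i : Fin N} {K : T.tri} :
    K ∈ D.layerFinset i ↔ K.1 ∈ D.layerTri i := by
  simp [layerFinset]

theorem layerFinset_nonempty {κ : ℝ} (hκ : 0 < κ) (h : D.ShapeRegular κ) (i : Fin N) :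
    (D.layerFinset i).Nonempty := by
  obtain ⟨φ, ψ, hc⟩ := D.exists_chart hκ h i
  obtain ⟨K, hK, -⟩ := D.exists_layerTri_of_mem_frontier
    (hc.mem_frontier (EuclideanSpace.single 0 1) (by simp))
  exact ⟨K, D.mem_layerFinset.2 hK⟩

variable {ρ κ : ℝ}

/-- The image of a layer triangle in the unit disc contains a disc of radius comparable to `h/H`
and lies in an annulus of width comparable to `h/H`. -/
theorem exists_ball_in_annulus (hρ : 0 < ρ) (hκ : 0 < κ) (hq : D.QuasiUniform ρ) {i : Fin N}
    (hH : 0 < D.coarseSize i) {φ ψ : Plane → Plane}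
    (hc : IsDiscChart (D.sub i) (κ * D.coarseSize i) (κ / D.coarseSize i) φ ψ)
    {K : T.tri} (hK : K.1 ∈ D.layerTri i) :
    ∃ c, ∀ x ∈ Metric.ball c (ρ * D.meshSize i / (κ * D.coarseSize i)),
      φ x ∈ interior (hull K.1) ∧ 1 - κ / D.coarseSize i * D.meshSize i ≤ ‖x‖ ∧ ‖x‖ < 1 := by
  obtain ⟨hKl, p, hpK, hpf⟩ := (D.mem_layerTri i K).1 hK
  have hh := D.meshSize_pos hKl
  obtain ⟨z, hz⟩ := hq i K.1 hKl
  set r := ρ * D.meshSize i / (κ * D.coarseSize i) with hr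
  have hA : 0 < κ * D.coarseSize i := by positivity
  have hr0 : 0 < r := by positivity
  have hrA : κ * D.coarseSize i * r = ρ * D.meshSize i := by rw [hr]; field_simp
  have hball : Metric.ball z (ρ * D.meshSize i) ⊆ interior (hull K.1) :=
    interior_maximal (Metric.ball_subset_closedBall.trans hz) Metric.isOpen_ball
  have hzU : z ∈ D.sub i :=
    D.interior_subset hKl (hball (Metric.mem_ball_self (by positivity)))
  have hz1 := hc.norm_lt z hzU
  have hinv := hc.right_inv z (subset_closure hzU)
  have himg : ∀ x ∈ Metric.ball (ψ z) r, ‖x‖ ≤ 1 → φ x ∈ interior (hull K.1) := by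
    intro x hx hx1
    refine hball ?_
    have h1 := hc.dist_le x (ψ z) hx1 hz1.le
    rw [hinv] at h1
    rw [Metric.mem_ball] at hx ⊢
    rw [← hrA]
    exact h1.trans_lt (by gcongr)
  refine ⟨ψ z, fun x hx => ?_⟩
  -- A disc leaving the open unit disc would contain a point of the unit circle, which `φ` would
  -- send both to `∂Ω_i` and into the open triangle.
  have hx1 : ‖x‖ < 1 := by
    by_contra! hcon
    obtain ⟨y, hy, hy1⟩ := (convex_ball (ψ z) r).isPreconnected.intermediate_value
      (Metric.mem_ball_self hr0) hx continuous_norm.continuousOn ⟨hz1.le, hcon⟩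
    exact Set.disjoint_left.1 (D.disjoint_frontier_interior i K) (hc.mem_frontier y hy1)
      (himg y hy hy1.le)
  have hxK := himg x hx hx1.le
  refine ⟨hxK, ?_, hx1⟩
  have h1 := hc.dist_inv_le (φ x) (subset_closure (hc.mem x hx1)) p (frontier_subset_closure hpf)
  rw [hc.left_inv x hx1.le] at h1
  have h2 : dist (φ x) p ≤ D.meshSize i :=
    (dist_le_diam_hull (_root_.interior_subset hxK) hpK).trans (D.diam_le_meshSize hKl)
  have h3 : dist x (ψ p) ≤ κ / D.coarseSize i * D.meshSize i := h1.trans (by gcongr)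
  have h4 := norm_sub_norm_le (ψ p) x
  rw [hc.norm_eq p hpf, ← dist_eq_norm, dist_comm] at h4
  linarith

/-- The number of triangles in the boundary layer is bounded by a multiple of `H/h`. -/
theorem card_layerFinset_le (hρ : 0 < ρ) (hκ : 0 < κ) (hq : D.QuasiUniform ρ)
    (hs : D.ShapeRegular κ) (i : Fin N) :
    ((D.layerFinset i).card : ℝ) ≤ 2 * κ ^ 3 / ρ ^ 2 * (D.coarseSize i / D.meshSize i) := by
  classical
  obtain ⟨φ, ψ, hc⟩ := D.exists_chart hκ hs i
  have hH := D.coarseSize_pos hs i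
  obtain ⟨K₀, hK₀⟩ := D.layerFinset_nonempty hκ hs i
  have hh := D.meshSize_pos (D.layer_local (D.mem_layerFinset.1 hK₀))
  have hex : ∀ K : T.tri, ∃ c, K.1 ∈ D.layerTri i →
      ∀ x ∈ Metric.ball c (ρ * D.meshSize i / (κ * D.coarseSize i)),
      φ x ∈ interior (hull K.1) ∧ 1 - κ / D.coarseSize i * D.meshSize i ≤ ‖x‖ ∧ ‖x‖ < 1 := by
    intro K
    by_cases hK : K.1 ∈ D.layerTri i
    · obtain ⟨c, h⟩ := D.exists_ball_in_annulus hρ hκ hq hH hc hK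
      exact ⟨c, fun _ => h⟩
    · exact ⟨0, fun h => absurd h hK⟩
  choose c hcK using hex
  have key := card_mul_sq_le_of_disjoint_balls (D.layerFinset i) c
    (r := ρ * D.meshSize i / (κ * D.coarseSize i)) (δ := κ / D.coarseSize i * D.meshSize i)
    (by positivity) (by positivity) ?_ ?_
  -- The packing bound is `2 δ / r²` with `δ = κ h / H` and `r = ρ h / (κ H)`.
  · have h1 : ((D.layerFinset i).card : ℝ) =
        (D.layerFinset i).card * (ρ * D.meshSize i / (κ * D.coarseSize i)) ^ 2 *
          (κ ^ 2 * D.coarseSize i ^ 2 / (ρ ^ 2 * D.meshSize i ^ 2)) := by field_simp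
    rw [h1]
    calc _ ≤ 2 * (κ / D.coarseSize i * D.meshSize i) *
          (κ ^ 2 * D.coarseSize i ^ 2 / (ρ ^ 2 * D.meshSize i ^ 2)) := by gcongr
      _ = _ := by field_simp
  · intro K hK L hL hKL
    refine Set.disjoint_left.2 fun x hxK hxL => hKL ?_
    exact T.eq_of_mem_interior (hcK K (D.mem_layerFinset.1 hK) x hxK).1
      (_root_.interior_subset (hcK L (D.mem_layerFinset.1 hL) x hxL).1)
  · exact fun K hK x hx => (hcK K (D.mem_layerFinset.1 hK) x hx).2

/-! ### Oscillation of a Crouzeix-Raviart function along the boundary -/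

/-- The sum over the boundary layer of the oscillation bounds `h |∇u|`. -/
def layerOsc (u : T.crSpace) (i : Fin N) : ℝ :=
  ∑ K ∈ D.layerFinset i, D.meshSize i * ‖gradient (u.1 K) 0‖

theorem abs_sub_le_of_mem_nodes (u : T.crSpace) {i : Fin N} {K : T.tri}
    (hK : K.1 ∈ D.localTri i) {x y : Plane} (hx : x ∈ nodes K.1) (hy : y ∈ nodes K.1) :
    |u.1 K x - u.1 K y| ≤ D.meshSize i * ‖gradient (u.1 K) 0‖ := by
  refine (abs_affine_sub_le _ x y).trans ?_
  rw [mul_comm]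
  gcongr
  exact (dist_le_diam_hull (nodes_subset_hull _ hx) (nodes_subset_hull _ hy)).trans
    (D.diam_le_meshSize hK)

/-- The difference telescopes through the nodes shared by consecutive triangles, where the two
affine pieces agree. Leaving `f` free off the layer allows an extension by zero. -/
theorem abs_sub_le_walk (u : T.crSpace) {i : Fin N} {f : T.tri → ℝ}
    (hf : ∀ K : T.tri, K.1 ∈ D.layerTri i → f K = D.meshSize i * ‖gradient (u.1 K) 0‖)
    {K L : T.tri} (w : (D.layerGraph i).Walk K L) (hK : K.1 ∈ D.layerTri i) {x y : Plane}
    (hx : x ∈ nodes K.1) (hy : y ∈ nodes L.1) :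
    |u.1 K x - u.1 L y| ≤ (w.support.map f).sum := by
  induction w generalizing x with
  | nil =>
    rw [SimpleGraph.Walk.support_nil, List.map_singleton, List.sum_singleton, hf _ hK]
    exact D.abs_sub_le_of_mem_nodes u (D.layer_local hK) hx hy
  | cons hadj w ih =>
    obtain ⟨-, -, hJ, z, hzK, hzJ⟩ := D.layerGraph_adj.1 hadj
    rw [SimpleGraph.Walk.support_cons, List.map_cons, List.sum_cons, hf _ hK]
    have h1 := D.abs_sub_le_of_mem_nodes u (D.layer_local hK) hx hzK
    have h2 := ih hJ hzJ hy
    rw [← u.2.1 _ _ z ⟨hzK, hzJ⟩] at h2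
    exact (abs_sub_le _ _ _).trans (add_le_add h1 h2)

theorem abs_nodalValue_sub_le (hκ : 0 < κ) (hs : D.ShapeRegular κ) (u : T.crSpace) {i : Fin N}
    {x y : Plane} (hx : x ∈ D.bdryNodes i) (hy : y ∈ D.bdryNodes i) :
    |T.nodalValue u x - T.nodalValue u y| ≤ D.layerOsc u i := by
  classical
  obtain ⟨φ, ψ, hc⟩ := D.exists_chart hκ hs i
  obtain ⟨K, hK, hxK⟩ := D.exists_layerTri_of_mem_bdryNodes hx
  obtain ⟨L, hL, hyL⟩ := D.exists_layerTri_of_mem_bdryNodes hy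
  rw [T.nodalValue_eq u K hxK, T.nodalValue_eq u L hyL]
  -- A path visits each triangle at most once, so its sum is at most the sum over the whole layer.
  obtain ⟨w, hw⟩ := (D.layerGraph_reachable hc hK hL).exists_isPath
  have hh := D.meshSize_pos (D.layer_local hK)
  set f : T.tri → ℝ := fun J =>
    if J.1 ∈ D.layerTri i then D.meshSize i * ‖gradient (u.1 J) 0‖ else 0
  have h1 := D.abs_sub_le_walk u (f := f) (fun J hJ => if_pos hJ) w hK hxK hyL
  rw [← List.sum_toFinset f hw.support_nodup] at h1
  refine h1.trans ((Finset.sum_le_univ_sum_of_nonneg fun J => ?_).trans_eq ?_)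
  · by_cases hJ : J.1 ∈ D.layerTri i
    · rw [if_pos hJ]
      positivity
    · rw [if_neg hJ]
  · rw [layerOsc, layerFinset, Finset.sum_filter]

theorem abs_nodalValue_sub_bdryMean_le (hκ : 0 < κ) (hs : D.ShapeRegular κ) (u : T.crSpace)
    {i : Fin N} {x : Plane} (hx : x ∈ D.bdryNodes i) :
    |T.nodalValue u x - D.bdryMean u i| ≤ D.layerOsc u i := by
  have hn : (0 : ℝ) < (D.bdryNodes i).card := by exact_mod_cast Finset.card_pos.2 ⟨x, hx⟩
  have h1 : T.nodalValue u x - D.bdryMean u i = 1 / ((D.bdryNodes i).card : ℝ) *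
      ∑ y ∈ D.bdryNodes i, (T.nodalValue u x - T.nodalValue u y) := by
    rw [bdryMean, Finset.sum_sub_distrib, Finset.sum_const, nsmul_eq_mul]
    field_simp
  rw [h1, abs_mul, abs_of_pos (by positivity)]
  calc _ ≤ 1 / ((D.bdryNodes i).card : ℝ) * ((D.bdryNodes i).card * D.layerOsc u i) := by
        gcongr
        refine (Finset.abs_sum_le_sum_abs _ _).trans ?_
        rw [← nsmul_eq_mul]
        exact Finset.sum_le_card_nsmul _ _ _ fun y hy => D.abs_nodalValue_sub_le hκ hs u hx hy
    _ = D.layerOsc u i := by field_simp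

theorem layerOsc_nonneg (u : T.crSpace) (i : Fin N) : 0 ≤ D.layerOsc u i :=
  Finset.sum_nonneg fun K hK => by
    have := D.meshSize_pos (D.layer_local (D.mem_layerFinset.1 hK))
    positivity

theorem abs_avgInterp_sub_le (hκ : 0 < κ) (hs : D.ShapeRegular κ) (u : T.crSpace) {i : Fin N}
    {K : T.tri} (hK : K.1 ∈ D.localTri i) {x : Plane} (hx : x ∈ nodes K.1) :
    |(D.avgInterp u).1 K x - D.bdryMean u i| ≤ D.layerOsc u i := by
  by_cases hxi : x ∈ D.sub i
  · rw [D.avgInterp_interior u K hx hxi, sub_self, abs_zero]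
    exact D.layerOsc_nonneg u i
  · have hxf : x ∈ frontier (D.sub i) := by
      rw [D.frontier_eq]
      exact ⟨(D.mem_localTri i K).1 hK (nodes_subset_hull _ hx), hxi⟩
    rw [D.avgInterp_boundary u K hx hxf, ← T.nodalValue_eq u K hx]
    exact D.abs_nodalValue_sub_bdryMean_le hκ hs u (D.mem_bdryNodes.2 ⟨⟨K, hx⟩, hxf⟩)

theorem norm_gradient_avgInterp_le (hρ : 0 < ρ) (hκ : 0 < κ) (hq : D.QuasiUniform ρ)
    (hs : D.ShapeRegular κ) (u : T.crSpace) {i : Fin N} {K : T.tri} (hK : K.1 ∈ D.localTri i) :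
    ρ * D.meshSize i * ‖gradient ((D.avgInterp u).1 K) 0‖ ≤ 3 * D.layerOsc u i := by
  obtain ⟨z, hz⟩ := hq i K.1 hK
  have hh := D.meshSize_pos hK
  exact mul_norm_gradient_le_of_nodes (T.card_eq K.1 K.2) (by positivity) hz
    fun x hx => D.abs_avgInterp_sub_le hκ hs u hK hx

/-- The average interpolant is constant on triangles away from the subdomain boundary. -/
theorem gradient_avgInterp_eq_zero (hρ : 0 < ρ) (hq : D.QuasiUniform ρ) (u : T.crSpace)
    {i : Fin N} {K : T.tri} (hK : K.1 ∈ D.localTri i) (hKl : K.1 ∉ D.layerTri i) :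
    gradient ((D.avgInterp u).1 K) 0 = 0 := by
  obtain ⟨z, hz⟩ := hq i K.1 hK
  have hh := D.meshSize_pos hK
  have h := mul_norm_gradient_le_of_nodes (f := (D.avgInterp u).1 K) (T.card_eq K.1 K.2)
    (c := D.bdryMean u i) (w := 0) (by positivity) hz fun x hx => by
      have hxi : x ∈ D.sub i := by
        by_contra hxi
        refine hKl ((D.mem_layerTri i K).2 ⟨hK, x, nodes_subset_hull _ hx, ?_⟩)
        rw [D.frontier_eq]
        exact ⟨(D.mem_localTri i K).1 hK (nodes_subset_hull _ hx), hxi⟩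
      rw [D.avgInterp_interior u K hx hxi, sub_self, abs_zero]
  rw [mul_zero] at h
  exact norm_le_zero_iff.1 (nonpos_of_mul_nonpos_right h (by positivity))

end Decomposition

/-! ### Energies -/

theorem interior_hull_ae_eq (K : Finset Plane) :
    interior (hull K) =ᵐ[(volume : Measure Plane)] hull K :=
  interior_ae_eq_of_null_frontier ((convex_hull K).addHaar_frontier volume)

theorem Triangulation.energy_self {Ω : Set Plane} (T : Triangulation Ω) (α : Plane → ℝ)
    (u : T.crSpace) :
    T.energy α u u = ∑ K : T.tri, ‖gradient (u.1 K) 0‖ ^ 2 * ∫ x in hull K.1, α x := by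
  refine Finset.sum_congr rfl fun K _ => ?_
  simp_rw [gradient_affine (u.1 K), real_inner_self_eq_norm_sq]
  rw [integral_mul_const, mul_comm]

namespace Decomposition

variable {Ω : Set Plane} {T : Triangulation Ω} {N : ℕ} (D : Decomposition T N)

/-- A closed triangle may leave the open set `Ω`, where nothing is known about `α`, but only along
its boundary, which is null by convexity. -/
theorem restrict_hull_le (K : T.tri) (D : Decomposition T N) :
    volume.restrict (hull K.1) ≤ volume.restrict Ω := by
  obtain ⟨i, hi⟩ := D.exists_mem_localTri K
  rw [← Measure.restrict_congr_set (interior_hull_ae_eq K.1)]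
  exact Measure.restrict_mono ((D.interior_subset hi).trans (D.subset i)) le_rfl

theorem volume_hull_ne_top (K : Finset Plane) : volume (hull K) ≠ ⊤ :=
  (isCompact_hull K).measure_lt_top.ne

theorem integrableOn_hull {α : Plane → ℝ} (hα : IsCoefficient Ω α) (K : T.tri)
    (D : Decomposition T N) : IntegrableOn α (hull K.1) := by
  have : IsFiniteMeasure (volume.restrict (hull K.1)) :=
    isFiniteMeasure_restrict.2 (volume_hull_ne_top K.1)
  obtain ⟨M, hM⟩ := hα.bddAbove
  obtain ⟨m, hm, hm'⟩ := hα.bddBelow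
  have hle := restrict_hull_le K D
  refine Integrable.of_bound (hα.aemeasurable.mono_measure hle).aestronglyMeasurable M ?_
  filter_upwards [ae_mono hle hM, ae_mono hle hm'] with x h1 h2
  rw [Real.norm_of_nonneg (hm.le.trans h2)]
  exact h1

theorem integral_nonneg_hull {α : Plane → ℝ} (hα : IsCoefficient Ω α) (K : T.tri)
    (D : Decomposition T N) : 0 ≤ ∫ x in hull K.1, α x := by
  obtain ⟨m, hm, hm'⟩ := hα.bddBelow
  refine integral_nonneg_of_ae ?_
  filter_upwards [ae_mono (restrict_hull_le K D) hm'] with x hx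
  exact hm.le.trans hx

theorem ae_layer {p : Plane → Prop} (hp : ∀ᵐ x ∂volume.restrict Ω, p x) (i : Fin N) :
    ∀ᵐ x ∂volume.restrict (D.layer i), p x := by
  rw [layer, ae_restrict_biUnion_finset_iff]
  intro K hK
  have hKT : K ∈ T.tri := by
    simp only [layerTri, localTri, Finset.mem_filter] at hK
    exact hK.1.1
  exact ae_mono (restrict_hull_le ⟨K, hKT⟩ D) hp

theorem hull_subset_layer {i : Fin N} {K : T.tri} (hK : K.1 ∈ D.layerTri i) :
    hull K.1 ⊆ D.layer i :=
  Set.subset_biUnion_of_mem (u := fun K : Finset Plane => hull K) hK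

theorem volume_hull_pos (K : T.tri) : 0 < volume (hull K.1) :=
  (isOpen_interior.measure_pos volume (T.interior_hull_nonempty K)).trans_le
    (measure_mono _root_.interior_subset)

theorem integral_le_alphaSup {α : Plane → ℝ} (hα : IsCoefficient Ω α) {i : Fin N} {K : T.tri}
    (hK : K.1 ∈ D.layerTri i) :
    ∫ x in hull K.1, α x ≤ D.alphaSup α i * volume.real (hull K.1) := by
  obtain ⟨M, hM⟩ := hα.bddAbove
  have h1 : ∀ᵐ x ∂volume.restrict (D.layer i), α x ≤ D.alphaSup α i :=
    ae_le_essSup ⟨M, by simpa using D.ae_layer hM i⟩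
  have h2 := ae_mono (Measure.restrict_mono (μ := volume) (D.hull_subset_layer hK) le_rfl) h1
  have h3 := integral_mono_ae (integrableOn_hull hα K D)
    (integrableOn_const (volume_hull_ne_top K.1)) h2
  rwa [setIntegral_const, smul_eq_mul, mul_comm] at h3

theorem alphaInf_le_integral {α : Plane → ℝ} (hα : IsCoefficient Ω α) {i : Fin N} {K : T.tri}
    (hK : K.1 ∈ D.layerTri i) :
    D.alphaInf α i * volume.real (hull K.1) ≤ ∫ x in hull K.1, α x := by
  obtain ⟨m, -, hm⟩ := hα.bddBelow
  have h1 : ∀ᵐ x ∂volume.restrict (D.layer i), D.alphaInf α i ≤ α x :=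
    ae_essInf_le ⟨m, by simpa using D.ae_layer hm i⟩
  have h2 := ae_mono (Measure.restrict_mono (μ := volume) (D.hull_subset_layer hK) le_rfl) h1
  have h3 := integral_mono_ae (f := fun _ => D.alphaInf α i)
    (integrableOn_const (volume_hull_ne_top K.1)) (integrableOn_hull hα K D) h2
  rwa [setIntegral_const, smul_eq_mul, mul_comm] at h3

theorem alphaInf_pos {α : Plane → ℝ} (hα : IsCoefficient Ω α) {i : Fin N} {K : T.tri}
    (hK : K.1 ∈ D.layerTri i) : 0 < D.alphaInf α i := by
  obtain ⟨m, hm, hm'⟩ := hα.bddBelow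
  obtain ⟨M, hM⟩ := hα.bddAbove
  have hne : (ae (volume.restrict (D.layer i))).NeBot := by
    rw [ae_neBot, Ne, Measure.restrict_eq_zero]
    exact ((volume_hull_pos K).trans_le (measure_mono (D.hull_subset_layer hK))).ne'
  -- The real-valued essential infimum is a genuine bound here because the layer has positive
  -- measure and `α` is essentially bounded above.
  have hb : Filter.IsBoundedUnder (· ≤ ·) (ae (volume.restrict (D.layer i))) α :=
    ⟨M, by simpa using D.ae_layer hM i⟩
  exact hm.trans_le (le_essInf_of_ae_le m (D.ae_layer hm' i) hb.isCoboundedUnder_ge)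

theorem alphaSup_nonneg {α : Plane → ℝ} (hα : IsCoefficient Ω α) {i : Fin N} {K : T.tri}
    (hK : K.1 ∈ D.layerTri i) : 0 ≤ D.alphaSup α i := by
  have h1 := (integral_nonneg_hull hα K D).trans (D.integral_le_alphaSup hα hK)
  have h2 : 0 < volume.real (hull K.1) :=
    ENNReal.toReal_pos (volume_hull_pos K).ne' (volume_hull_ne_top K.1)
  exact nonneg_of_mul_nonneg_left h1 h2

theorem volume_hull_le {i : Fin N} {K : T.tri} (hK : K.1 ∈ D.localTri i) :
    volume.real (hull K.1) ≤ Real.pi * D.meshSize i ^ 2 := by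
  obtain ⟨x, hx⟩ := (T.interior_hull_nonempty K).mono _root_.interior_subset
  rw [← volume_real_closedBall x (D.meshSize_pos hK).le]
  refine measureReal_mono (fun y hy => ?_) measure_closedBall_lt_top.ne
  exact (dist_le_diam_hull hy hx).trans (D.diam_le_meshSize hK)

theorem le_volume_hull {ρ : ℝ} (hρ : 0 < ρ) (hq : D.QuasiUniform ρ) {i : Fin N} {K : T.tri}
    (hK : K.1 ∈ D.localTri i) :
    Real.pi * (ρ * D.meshSize i) ^ 2 ≤ volume.real (hull K.1) := by
  obtain ⟨z, hz⟩ := hq i K.1 hK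
  have hh := D.meshSize_pos hK
  rw [← volume_real_closedBall z (by positivity)]
  exact measureReal_mono hz (volume_hull_ne_top K.1)

open scoped Classical in
/-- The part of the energy coming from the triangles of `Ω_i`. -/
def localEnergy (α : Plane → ℝ) (u : T.crSpace) (i : Fin N) : ℝ :=
  ∑ K : T.tri with K.1 ∈ D.localTri i, ‖gradient (u.1 K) 0‖ ^ 2 * ∫ x in hull K.1, α x

theorem energy_eq_sum_localEnergy (α : Plane → ℝ) (u : T.crSpace) :
    T.energy α u u = ∑ i, D.localEnergy α u i := by
  classical
  choose idx hidx using D.exists_mem_localTri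
  rw [T.energy_self, ← Finset.sum_fiberwise _ idx]
  refine Finset.sum_congr rfl fun i _ => Finset.sum_congr ?_ fun _ _ => rfl
  ext K
  simp only [Finset.mem_filter, Finset.mem_univ, true_and]
  constructor
  · rintro rfl
    exact hidx K
  · exact fun h => D.localTri_unique (hidx K) h

theorem localEnergy_nonneg {α : Plane → ℝ} (hα : IsCoefficient Ω α) (u : T.crSpace)
    (i : Fin N) : 0 ≤ D.localEnergy α u i :=
  Finset.sum_nonneg fun K _ => mul_nonneg (sq_nonneg _) (integral_nonneg_hull hα K D)

/-! ### Local energy estimates -/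

variable {ρ κ : ℝ}

theorem sum_layer_le_localEnergy {α : Plane → ℝ} (hα : IsCoefficient Ω α) (u : T.crSpace)
    (i : Fin N) :
    ∑ K ∈ D.layerFinset i, ‖gradient (u.1 K) 0‖ ^ 2 * ∫ x in hull K.1, α x ≤
      D.localEnergy α u i := by
  classical
  refine Finset.sum_le_sum_of_subset_of_nonneg (fun K hK => ?_)
    fun K _ _ => mul_nonneg (sq_nonneg _) (integral_nonneg_hull hα K D)
  simpa using D.layer_local (D.mem_layerFinset.1 hK)

theorem localEnergy_avgInterp_eq (hρ : 0 < ρ) (hq : D.QuasiUniform ρ) (α : Plane → ℝ)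
    (u : T.crSpace) (i : Fin N) :
    D.localEnergy α (D.avgInterp u) i = ∑ K ∈ D.layerFinset i,
      ‖gradient ((D.avgInterp u).1 K) 0‖ ^ 2 * ∫ x in hull K.1, α x := by
  classical
  symm
  refine Finset.sum_subset (fun K hK => ?_) fun K hK hKl => ?_
  · simpa using D.layer_local (D.mem_layerFinset.1 hK)
  · rw [D.gradient_avgInterp_eq_zero hρ hq u (by simpa using hK)
      fun h => hKl (D.mem_layerFinset.2 h)]
    simp

/-- Cauchy-Schwarz costs the number of layer triangles. The inscribed disc gives `π ρ² h² ≤ |K|`,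
which turns `h² |∇u|²` into an energy. -/
theorem layerOsc_sq_le (hρ : 0 < ρ) (hκ : 0 < κ) (hq : D.QuasiUniform ρ) (hs : D.ShapeRegular κ)
    {α : Plane → ℝ} (hα : IsCoefficient Ω α) (u : T.crSpace) (i : Fin N) :
    D.layerOsc u i ^ 2 ≤ (D.layerFinset i).card *
      (D.localEnergy α u i / (Real.pi * ρ ^ 2 * D.alphaInf α i)) := by
  obtain ⟨K₀, hK₀⟩ := D.layerFinset_nonempty hκ hs i
  rw [D.mem_layerFinset] at hK₀
  have ha := D.alphaInf_pos hα hK₀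
  refine sq_sum_le_card_mul_sum_sq.trans ?_
  gcongr
  rw [le_div_iff₀ (by positivity), Finset.sum_mul]
  refine le_trans (Finset.sum_le_sum fun K hK => ?_) (D.sum_layer_le_localEnergy hα u i)
  rw [D.mem_layerFinset] at hK
  calc (D.meshSize i * ‖gradient (u.1 K) 0‖) ^ 2 * (Real.pi * ρ ^ 2 * D.alphaInf α i)
      = ‖gradient (u.1 K) 0‖ ^ 2 *
          (D.alphaInf α i * (Real.pi * (ρ * D.meshSize i) ^ 2)) := by ring
    _ ≤ ‖gradient (u.1 K) 0‖ ^ 2 * (D.alphaInf α i * volume.real (hull K.1)) := by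
        gcongr
        exact D.le_volume_hull hρ hq (D.layer_local hK)
    _ ≤ _ := by
        gcongr
        exact D.alphaInf_le_integral hα hK

/-- Each layer triangle has area at most `π h²` and carries a gradient of size at most `3 layerOsc /
(ρ h)`; the powers of `h` cancel, as is typical in two dimensions. -/
theorem localEnergy_avgInterp_le_layerOsc (hρ : 0 < ρ) (hκ : 0 < κ) (hq : D.QuasiUniform ρ)
    (hs : D.ShapeRegular κ) {α : Plane → ℝ} (hα : IsCoefficient Ω α) (u : T.crSpace)
    (i : Fin N) :
    D.localEnergy α (D.avgInterp u) i ≤ (D.layerFinset i).card *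
      (9 * Real.pi / ρ ^ 2 * D.alphaSup α i * D.layerOsc u i ^ 2) := by
  rw [D.localEnergy_avgInterp_eq hρ hq, ← nsmul_eq_mul]
  refine Finset.sum_le_card_nsmul _ _ _ fun K hK => ?_
  rw [D.mem_layerFinset] at hK
  have hh := D.meshSize_pos (D.layer_local hK)
  have hg := D.norm_gradient_avgInterp_le hρ hκ hq hs u (D.layer_local hK)
  have ha := D.alphaSup_nonneg hα hK
  calc ‖gradient ((D.avgInterp u).1 K) 0‖ ^ 2 * ∫ x in hull K.1, α x
      ≤ ‖gradient ((D.avgInterp u).1 K) 0‖ ^ 2 *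
          (D.alphaSup α i * (Real.pi * D.meshSize i ^ 2)) := by
        gcongr
        refine (D.integral_le_alphaSup hα hK).trans ?_
        gcongr
        exact D.volume_hull_le (D.layer_local hK)
    _ = (ρ * D.meshSize i * ‖gradient ((D.avgInterp u).1 K) 0‖) ^ 2 *
          (Real.pi / ρ ^ 2 * D.alphaSup α i) := by field_simp
    _ ≤ (3 * D.layerOsc u i) ^ 2 * (Real.pi / ρ ^ 2 * D.alphaSup α i) := by gcongr
    _ = _ := by ring

theorem localEnergy_avgInterp_le (hρ : 0 < ρ) (hκ : 0 < κ) (hq : D.QuasiUniform ρ)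
    (hs : D.ShapeRegular κ) {α : Plane → ℝ} (hα : IsCoefficient Ω α) (u : T.crSpace)
    (i : Fin N) :
    D.localEnergy α (D.avgInterp u) i ≤ 36 * κ ^ 6 / ρ ^ 8 *
      (D.alphaSup α i / D.alphaInf α i * (D.coarseSize i ^ 2 / D.meshSize i ^ 2)) *
        D.localEnergy α u i := by
  obtain ⟨K₀, hK₀⟩ := D.layerFinset_nonempty hκ hs i
  rw [D.mem_layerFinset] at hK₀
  have ha := D.alphaInf_pos hα hK₀
  have hb := D.alphaSup_nonneg hα hK₀
  have hE := D.localEnergy_nonneg hα u i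
  have hh := D.meshSize_pos (D.layer_local hK₀)
  have hpi := Real.pi_pos
  have hm := D.card_layerFinset_le hρ hκ hq hs i
  calc D.localEnergy α (D.avgInterp u) i
      ≤ (D.layerFinset i).card * (9 * Real.pi / ρ ^ 2 * D.alphaSup α i * D.layerOsc u i ^ 2) :=
        D.localEnergy_avgInterp_le_layerOsc hρ hκ hq hs hα u i
    _ ≤ (D.layerFinset i).card * (9 * Real.pi / ρ ^ 2 * D.alphaSup α i *
          ((D.layerFinset i).card *
            (D.localEnergy α u i / (Real.pi * ρ ^ 2 * D.alphaInf α i)))) := by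
        gcongr
        exact D.layerOsc_sq_le hρ hκ hq hs hα u i
    _ = ((D.layerFinset i).card : ℝ) ^ 2 *
          (9 / ρ ^ 4 * (D.alphaSup α i / D.alphaInf α i) * D.localEnergy α u i) := by
        field_simp
    -- The square of the counting bound gives `4 κ⁶ / ρ⁴` and `H²/h²`; with `9 / ρ⁴` this makes `36
    -- κ⁶ / ρ⁸`.
    _ ≤ (2 * κ ^ 3 / ρ ^ 2 * (D.coarseSize i / D.meshSize i)) ^ 2 *
          (9 / ρ ^ 4 * (D.alphaSup α i / D.alphaInf α i) * D.localEnergy α u i) := by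
        gcongr
    _ = _ := by
        field_simp
        ring

end Decomposition

end

end CRSchwarz

theorem mainTheorem7 (ρ κ : ℝ) (hρ : 0 < ρ) (hκ : 0 < κ) :
    ∃ C : ℝ, 0 < C ∧
      ∀ (Ω : Set CRSchwarz.Plane), IsOpen Ω → IsConnected Ω →
      ∀ (T : CRSchwarz.Triangulation Ω) (N : ℕ) (D : CRSchwarz.Decomposition T N),
        D.QuasiUniform ρ → D.ShapeRegular κ →
      ∀ (α : CRSchwarz.Plane → ℝ), CRSchwarz.IsCoefficient Ω α →
      ∀ u : T.crSpace,
        T.energy α (D.avgInterp u) (D.avgInterp u) ≤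
          C * (⨆ i : Fin N, D.alphaSup α i / D.alphaInf α i *
            (D.coarseSize i ^ 2 / D.meshSize i ^ 2)) * T.energy α u u := by
  refine ⟨36 * κ ^ 6 / ρ ^ 8, by positivity, ?_⟩
  intro Ω _ _ T N D hq hs α hα u
  rw [D.energy_eq_sum_localEnergy, D.energy_eq_sum_localEnergy, Finset.mul_sum]
  refine Finset.sum_le_sum fun i _ => (D.localEnergy_avgInterp_le hρ hκ hq hs hα u i).trans ?_
  have hE := D.localEnergy_nonneg hα u i
  gcongr
  exact le_ciSup (f := fun i : Fin N => D.alphaSup α i / D.alphaInf α i *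
    (D.coarseSize i ^ 2 / D.meshSize i ^ 2)) (Set.finite_range _).bddAbove i
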